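/- Let $\Gamma$ be a discrete group with left regular representation $\lambda$ on $\ell^2(\Gamma)$, $(\lambda(g)\xi)(h)=\xi(g^{-1}h)$, and let $C_r^*(\Gamma)\subseteq B(\ell^2(\Gamma))$ be its reduced group $C^*$-algebra, i.e. the $C^*$-algebra generated by $\lambda(\Gamma)$. For a subgroup $N\le\Gamma$, regard $C_r^*(N)$ as the $C^*$-subalgebra of $C_r^*(\Gamma)$ generated by $\{\lambda(n): n\in N\}$. The group $\Gamma$ has the $C^*$-ISR property (invariant subalgebra rigidity) if every unital $C^*$-subalgebra $\mathcal A\subseteq C_r^*(\Gamma)$ with $\lambda(g)\mathcal A\lambda(g)^*\subseteq\mathcal A$ for all $g\in\Gamma$ is equal to $C_r^*(N)$ for some normal subgroup $N\triangleleft\Gamma$. The group $\Gamma$ is $C^*$-simple if the only closed two-sided ideals of $C_r^*(\Gamma)$ are $0$ and $C_r^*(\Gamma)$; it is amenable if it admits a left-invariant finitely additive probability measure defined on all its subsets; and it is i.c.c. if the conjugacy class of every $g\in\Gamma$ with $g\neq e$ is infinite. **Theorem.** Let $\Gamma$ be a countable infinite group with the $C^*$-ISR property. Then $\Gamma$ is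 $C^*$-simple, or $\Gamma$ is a simple group that is amenable. In particular, $\Gamma$ is i.c.c. -/

import Mathlib

open scoped ENNReal

namespace CStarISR

/-- The Hilbert space `ℓ²(Γ)` of square summable complex functions on `Γ`. -/
abbrev EllTwo (Γ : Type*) : Type _ := lp (fun _ : Γ => ℂ) 2

section

variable {Γ : Type*} [Group Γ]

theorem memℓp_translate (g : Γ) {ξ : Γ → ℂ} (hξ : Memℓp ξ 2) :
    Memℓp (fun h => ξ (g⁻¹ * h)) 2 := by
  have hp : (0 : ℝ) < (2 : ℝ≥0∞).toReal := by norm_num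
  exact memℓp_gen ((Equiv.mulLeft g⁻¹).summable_iff.mpr ((memℓp_gen_iff hp).mp hξ))

/-- Left translation on `ℓ²(Γ)` as a linear isometry: `(λ_g ξ)(h) = ξ(g⁻¹h)`. -/
noncomputable def translate (g : Γ) : EllTwo Γ →ₗᵢ[ℂ] EllTwo Γ where
  toFun ξ := ⟨fun h => ξ (g⁻¹ * h), memℓp_translate g ξ.2⟩
  map_add' _ _ := rfl
  map_smul' _ _ := rfl
  norm_map' ξ := by
    have hp : (0 : ℝ) < (2 : ℝ≥0∞).toReal := by norm_num
    rw [lp.norm_eq_tsum_rpow hp, lp.norm_eq_tsum_rpow hp]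
    congr 1
    exact (Equiv.mulLeft g⁻¹).tsum_eq (fun h => ‖ξ h‖ ^ (2 : ℝ≥0∞).toReal)

/-- The left regular representation `λ` of `Γ` on `ℓ²(Γ)`. -/
noncomputable def leftRegular : Γ →* (EllTwo Γ →L[ℂ] EllTwo Γ) where
  toFun g := (translate g).toContinuousLinearMap
  map_one' := by
    ext ξ h
    change ξ ((1 : Γ)⁻¹ * h) = ξ h
    simp
  map_mul' g k := by
    ext ξ h
    change ξ ((g * k)⁻¹ * h) = ξ (k⁻¹ * (g⁻¹ * h))
    simp [mul_assoc]

theorem leftRegular_apply (g : Γ) (ξ : EllTwo Γ) (h : Γ) :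
    leftRegular g ξ h = ξ (g⁻¹ * h) := rfl

/-- For a subgroup `N ≤ Γ`, the C*-algebra `C*_r(N)`, viewed inside `B(ℓ²(Γ))` as the
C*-algebra generated by `{λ(n) : n ∈ N}`. -/
noncomputable def reducedSubalgebra (N : Subgroup Γ) :
    StarSubalgebra ℂ (EllTwo Γ →L[ℂ] EllTwo Γ) :=
  (StarAlgebra.adjoin ℂ (leftRegular '' (N : Set Γ))).topologicalClosure

variable (Γ)

/-- The reduced group C*-algebra `C*_r(Γ)`: the C*-algebra generated by the left regular
representation in `B(ℓ²(Γ))`. -/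
noncomputable def reducedCStarAlgebra : StarSubalgebra ℂ (EllTwo Γ →L[ℂ] EllTwo Γ) :=
  (StarAlgebra.adjoin ℂ (Set.range (leftRegular (Γ := Γ)))).topologicalClosure

variable {Γ}

/-- `A` is a `Γ`-invariant (unital) C*-subalgebra of `C*_r(Γ)`. -/
structure IsInvariantSubalgebra (A : StarSubalgebra ℂ (EllTwo Γ →L[ℂ] EllTwo Γ)) : Prop where
  le_reduced : A ≤ reducedCStarAlgebra Γ
  isClosed : IsClosed (A : Set (EllTwo Γ →L[ℂ] EllTwo Γ))
  conj_mem : ∀ (g : Γ), ∀ a ∈ A, leftRegular g * a * star (leftRegular g) ∈ A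

variable (Γ)

/-- The C*-ISR property: every invariant subalgebra of `C*_r(Γ)` is `C*_r(N)` for some normal
subgroup `N` of `Γ`. -/
def HasCStarISR : Prop :=
  ∀ A : StarSubalgebra ℂ (EllTwo Γ →L[ℂ] EllTwo Γ), IsInvariantSubalgebra A →
    ∃ N : Subgroup Γ, N.Normal ∧ A = reducedSubalgebra N

/-- `Γ` is C*-simple: the only closed two-sided ideals of `C*_r(Γ)` are `0` and `C*_r(Γ)`. -/
def IsCStarSimple : Prop :=
  ∀ I : TwoSidedIdeal (reducedCStarAlgebra Γ),
    IsClosed (I : Set (reducedCStarAlgebra Γ)) → I = ⊥ ∨ I = ⊤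

/-- The discrete group `Γ` is amenable: it carries a left-invariant finitely additive
probability measure defined on all its subsets. -/
def IsAmenable : Prop :=
  ∃ μ : Set Γ → ℝ,
    (∀ S, 0 ≤ μ S) ∧ μ Set.univ = 1 ∧
    (∀ S T, Disjoint S T → μ (S ∪ T) = μ S + μ T) ∧
    (∀ (g : Γ) (S : Set Γ), μ ((fun h => g * h) '' S) = μ S)

/-- `Γ` is i.c.c.: every nontrivial conjugacy class of `Γ` is infinite. -/
def IsICC : Prop :=
  ∀ g : Γ, g ≠ 1 → (conjugatesOf g).Infinite

end

end CStarISR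

/-!
The C*-ISR property is applied to the invariant subalgebras `ℂ + J`, where `J` is a closed
self-adjoint two-sided ideal of `C*_r(Γ)`.

If `J ≠ 0`, then `ℂ + J = C*_r(Γ)` (`HasCStarISR.exists_sub_smul_one_mem`): writing `ℂ + J` as
`C*_r(N)`, for `g ∉ N` both `J` and `λ(g)J ⊆ J` have Fourier coefficients supported in `N`, which
forces `J = 0`. So if `Γ` is not C*-simple, some proper ideal `J` has codimension one (for an
arbitrary closed ideal `I` one uses `J = I ∩ I*`, which avoids the theorem that closed ideals of
C*-algebras are self-adjoint). Modulo `J` each `λ(g)` is a scalar of modulus one, so for suitable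
unimodular `c_g` the sum of `c_g λ(g)` over `k` group elements has norm `k`; the absolute values of
vectors almost attaining this norm are almost invariant
(`IsReducedIdeal.hasAlmostInvariantVectors`), and `Γ` is amenable
(`HasAlmostInvariantVectors.isAmenable`).

Simplicity of `Γ` uses a second ideal. For `N` normal and nontrivial let `J` be the closed ideal
generated by the elements `1 - λ(n)`, `n ∈ N`; as before every `λ(g)` is a scalar modulo `J`.
Almost invariant vectors may be chosen supported in one coset of `N`. They are almost killed by
`J`, whereas `λ(g) - c` does not shrink them if `g ∉ N`, as `λ(g)` moves the coset off itself
(`HasAlmostInvariantVectors.sub_smul_one_notMem`). Hence `N = Γ`.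

Finally, `Γ` is i.c.c. in both cases: a finite conjugacy class gives a central element of `C*_r(Γ)`,
which is a scalar if `Γ` is C*-simple, and in an infinite simple group an element with finitely many
conjugates is central, hence trivial.
-/

namespace CStarISR

/-! ### The reduced C*-algebra as a closed linear span -/

section Basic

variable {Γ : Type*} [Group Γ]

theorem leftRegular_norm_apply (g : Γ) (ξ : EllTwo Γ) : ‖leftRegular g ξ‖ = ‖ξ‖ :=
  (translate g).norm_map ξ

theorem star_leftRegular (g : Γ) : star (leftRegular g) = leftRegular g⁻¹ := by
  have h : star (leftRegular g) * leftRegular g = 1 := by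
    have := (ContinuousLinearMap.norm_map_iff_adjoint_comp_self (leftRegular g)).mp
      (leftRegular_norm_apply g)
    exact this
  calc star (leftRegular g) = star (leftRegular g) * (leftRegular g * leftRegular g⁻¹) := by
        rw [← map_mul]; simp
    _ = leftRegular g⁻¹ := by rw [← mul_assoc, h, one_mul]

theorem leftRegular_mem_reducedSubalgebra {N : Subgroup Γ} {g : Γ} (hg : g ∈ N) :
    leftRegular g ∈ reducedSubalgebra N :=
  StarSubalgebra.le_topologicalClosure _
    (StarAlgebra.subset_adjoin ℂ _ (Set.mem_image_of_mem _ hg))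

theorem reducedSubalgebra_top : reducedSubalgebra (⊤ : Subgroup Γ) = reducedCStarAlgebra Γ := by
  simp [reducedSubalgebra, reducedCStarAlgebra]

theorem leftRegular_mem (g : Γ) : leftRegular g ∈ reducedCStarAlgebra Γ :=
  reducedSubalgebra_top (Γ := Γ) ▸ leftRegular_mem_reducedSubalgebra (Subgroup.mem_top g)

theorem isClosed_reducedCStarAlgebra :
    IsClosed (reducedCStarAlgebra Γ : Set (EllTwo Γ →L[ℂ] EllTwo Γ)) :=
  StarSubalgebra.isClosed_topologicalClosure _

/-- `C*_r(N)` is the closed linear span of `λ(N)`. -/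
theorem mem_of_mem_reducedSubalgebra {N : Subgroup Γ}
    (V : Submodule ℂ (EllTwo Γ →L[ℂ] EllTwo Γ))
    (hV : IsClosed (V : Set (EllTwo Γ →L[ℂ] EllTwo Γ)))
    (hN : ∀ g ∈ N, leftRegular g ∈ V) {x : EllTwo Γ →L[ℂ] EllTwo Γ}
    (hx : x ∈ reducedSubalgebra N) : x ∈ V := by
  have hstar : star (leftRegular '' (N : Set Γ)) ⊆ leftRegular '' (N : Set Γ) := by
    rintro y hy
    obtain ⟨g, hg, h⟩ := Set.mem_star.mp hy
    exact ⟨g⁻¹, N.inv_mem hg, by rw [← star_leftRegular, h, star_star]⟩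
  have hcl : (Submonoid.closure (leftRegular '' (N : Set Γ) ∪ star (leftRegular '' (N : Set Γ)))
      : Set (EllTwo Γ →L[ℂ] EllTwo Γ)) ⊆ V := by
    rw [Set.union_eq_self_of_subset_right hstar]
    have : Submonoid.closure (leftRegular '' (N : Set Γ)) ≤ N.toSubmonoid.map leftRegular :=
      Submonoid.closure_le.mpr (by intro y hy; exact hy)
    intro y hy
    obtain ⟨g, hg, rfl⟩ := this hy
    exact hN g hg
  have hadj : (StarAlgebra.adjoin ℂ (leftRegular '' (N : Set Γ)) :
      Set (EllTwo Γ →L[ℂ] EllTwo Γ)) ⊆ V := by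
    intro y hy
    have hy' : y ∈ Subalgebra.toSubmodule
        (StarAlgebra.adjoin ℂ (leftRegular '' (N : Set Γ))).toSubalgebra := hy
    rw [StarAlgebra.adjoin_eq_span] at hy'
    exact Submodule.span_le.mpr hcl hy'
  exact closure_minimal hadj hV hx

theorem mem_of_mem_reducedCStarAlgebra (V : Submodule ℂ (EllTwo Γ →L[ℂ] EllTwo Γ))
    (hV : IsClosed (V : Set (EllTwo Γ →L[ℂ] EllTwo Γ)))
    (h : ∀ g, leftRegular g ∈ V) {x : EllTwo Γ →L[ℂ] EllTwo Γ}
    (hx : x ∈ reducedCStarAlgebra Γ) : x ∈ V :=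
  mem_of_mem_reducedSubalgebra V hV (fun g _ => h g) (reducedSubalgebra_top (Γ := Γ) ▸ hx)

end Basic

/-! ### Ideals and invariant subalgebras -/

section Ideals

variable {Γ : Type*} [Group Γ]

/-- A closed self-adjoint two-sided ideal of `C*_r(Γ)`, as a subspace of `B(ℓ²(Γ))`. Stability
under multiplication is only required for the group elements; it extends to `C*_r(Γ)` by
density, see `IsReducedIdeal.mul_mem_left` and `IsReducedIdeal.mul_mem_right`. -/
structure IsReducedIdeal (J : Submodule ℂ (EllTwo Γ →L[ℂ] EllTwo Γ)) : Prop where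
  le_reduced : ∀ x ∈ J, x ∈ reducedCStarAlgebra Γ
  isClosed : IsClosed (J : Set (EllTwo Γ →L[ℂ] EllTwo Γ))
  star_mem : ∀ x ∈ J, star x ∈ J
  leftRegular_mul_mem : ∀ g, ∀ x ∈ J, leftRegular g * x ∈ J
  mul_leftRegular_mem : ∀ g, ∀ x ∈ J, x * leftRegular g ∈ J

namespace IsReducedIdeal

variable {J : Submodule ℂ (EllTwo Γ →L[ℂ] EllTwo Γ)}

theorem mul_mem_left (hJ : IsReducedIdeal J) {a x : EllTwo Γ →L[ℂ] EllTwo Γ}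
    (ha : a ∈ reducedCStarAlgebra Γ) (hx : x ∈ J) : a * x ∈ J :=
  mem_of_mem_reducedCStarAlgebra (J.comap (LinearMap.mulRight ℂ x))
    (hJ.isClosed.preimage (continuous_mul_const x)) (fun g => hJ.leftRegular_mul_mem g x hx) ha

theorem mul_mem_right (hJ : IsReducedIdeal J) {a x : EllTwo Γ →L[ℂ] EllTwo Γ}
    (ha : a ∈ reducedCStarAlgebra Γ) (hx : x ∈ J) : x * a ∈ J :=
  mem_of_mem_reducedCStarAlgebra (J.comap (LinearMap.mulLeft ℂ x))
    (hJ.isClosed.preimage (continuous_const_mul x)) (fun g => hJ.mul_leftRegular_mem g x hx) ha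

/-- An ideal that contains an element at distance less than `1` from the unit contains the unit. -/
theorem one_mem_of_norm_lt_one (hJ : IsReducedIdeal J) {b : EllTwo Γ →L[ℂ] EllTwo Γ}
    (hb : b ∈ reducedCStarAlgebra Γ) (hlt : ‖b‖ < 1) (h : 1 - b ∈ J) : 1 ∈ J := by
  -- `J` contains every `1 - b ^ n`, and these converge to `1`.
  have hpow : ∀ n : ℕ, 1 - b ^ n ∈ J := by
    intro n
    induction n with
    | zero => simp
    | succ n ih =>
      have : 1 - b ^ (n + 1) = (1 - b) + b * (1 - b ^ n) := by
        rw [mul_sub, mul_one, pow_succ']; abel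
      rw [this]
      exact J.add_mem h (hJ.mul_mem_left hb ih)
  have hlim : Filter.Tendsto (fun n : ℕ => 1 - b ^ n) Filter.atTop (nhds (1 - 0)) :=
    tendsto_const_nhds.sub (tendsto_pow_atTop_nhds_zero_of_norm_lt_one hlt)
  rw [sub_zero] at hlim
  exact hJ.isClosed.mem_of_tendsto hlim (Filter.Eventually.of_forall hpow)

/-- The unital C*-algebra `ℂ + J` attached to an ideal `J`. -/
def unitization (hJ : IsReducedIdeal J) : StarSubalgebra ℂ (EllTwo Γ →L[ℂ] EllTwo Γ) where
  carrier := {x | ∃ c : ℂ, x - c • 1 ∈ J}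
  mul_mem' := by
    rintro x y ⟨c, hx⟩ ⟨d, hy⟩
    refine ⟨c * d, ?_⟩
    have : x * y - (c * d) • (1 : EllTwo Γ →L[ℂ] EllTwo Γ) =
        (x - c • 1) * (y - d • 1) + d • (x - c • 1) + c • (y - d • 1) := by
      simp only [sub_mul, mul_sub, smul_mul_assoc, mul_smul_comm, mul_one, one_mul, smul_sub,
        smul_smul, mul_comm d c]
      abel
    rw [this]
    exact J.add_mem (J.add_mem (hJ.mul_mem_left (hJ.le_reduced _ hx) hy) (J.smul_mem _ hx))
      (J.smul_mem _ hy)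
  add_mem' := by
    rintro x y ⟨c, hx⟩ ⟨d, hy⟩
    refine ⟨c + d, ?_⟩
    convert! J.add_mem hx hy using 1
    rw [add_smul]; abel
  algebraMap_mem' r := ⟨r, by simp [Algebra.algebraMap_eq_smul_one]⟩
  star_mem' := by
    rintro x ⟨c, hx⟩
    exact ⟨star c, by simpa using hJ.star_mem _ hx⟩

theorem mem_unitization (hJ : IsReducedIdeal J) {x : EllTwo Γ →L[ℂ] EllTwo Γ} :
    x ∈ hJ.unitization ↔ ∃ c : ℂ, x - c • 1 ∈ J := Iff.rfl

theorem le_unitization (hJ : IsReducedIdeal J) {x : EllTwo Γ →L[ℂ] EllTwo Γ} (hx : x ∈ J) :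
    x ∈ hJ.unitization := ⟨0, by simpa using hx⟩

theorem isClosed_unitization (hJ : IsReducedIdeal J) :
    IsClosed (hJ.unitization : Set (EllTwo Γ →L[ℂ] EllTwo Γ)) := by
  convert! Submodule.isClosed_sup_finiteDimensional J (Submodule.span ℂ {1}) hJ.isClosed
  ext x
  simp only [SetLike.mem_coe, mem_unitization, Submodule.mem_sup, Submodule.mem_span_singleton]
  constructor
  · rintro ⟨c, hc⟩
    exact ⟨_, hc, _, ⟨c, rfl⟩, by abel⟩
  · rintro ⟨y, hy, _, ⟨c, rfl⟩, rfl⟩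
    exact ⟨c, by simpa using hy⟩

theorem isInvariantSubalgebra_unitization (hJ : IsReducedIdeal J) :
    IsInvariantSubalgebra hJ.unitization where
  le_reduced := by
    rintro x ⟨c, hx⟩
    simpa using add_mem (hJ.le_reduced _ hx) (SMulMemClass.smul_mem c (one_mem _))
  isClosed := hJ.isClosed_unitization
  conj_mem := by
    rintro g x ⟨c, hx⟩
    refine ⟨c, ?_⟩
    have h1 : leftRegular g * leftRegular g⁻¹ = (1 : EllTwo Γ →L[ℂ] EllTwo Γ) := by
      rw [← map_mul]; simp
    have : leftRegular g * x * star (leftRegular g) - c • 1 =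
        leftRegular g * (x - c • 1) * leftRegular g⁻¹ := by
      simp [star_leftRegular, mul_sub, sub_mul, h1]
    rw [this]
    exact hJ.mul_leftRegular_mem _ _ (hJ.leftRegular_mul_mem _ _ hx)

end IsReducedIdeal

/-- The evaluation `x ↦ (x δ₁)(k)`, which reads off the Fourier coefficient of `x` at `k`. -/
noncomputable def coeff (k : Γ) : (EllTwo Γ →L[ℂ] EllTwo Γ) →L[ℂ] ℂ :=
  by
    classical
    exact (lp.evalCLM ℂ (fun _ : Γ => ℂ) 2 k).comp
      (ContinuousLinearMap.apply ℂ (EllTwo Γ) (lp.single 2 (1 : Γ) (1 : ℂ)))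

open Classical in
theorem coeff_apply (k : Γ) (x : EllTwo Γ →L[ℂ] EllTwo Γ) :
    coeff k x = x (lp.single 2 (1 : Γ) (1 : ℂ)) k := rfl

theorem coeff_leftRegular_mul (g k : Γ) (x : EllTwo Γ →L[ℂ] EllTwo Γ) :
    coeff k (leftRegular g * x) = coeff (g⁻¹ * k) x := rfl

open Classical in
theorem leftRegular_single (g h : Γ) :
    leftRegular g (lp.single 2 h (1 : ℂ)) = lp.single 2 (g * h) (1 : ℂ) := by
  ext k
  rw [leftRegular_apply, lp.single_apply, lp.single_apply, Pi.single_apply, Pi.single_apply]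
  simp [inv_mul_eq_iff_eq_mul]

open Classical in
theorem coeff_leftRegular (g k : Γ) :
    coeff k (leftRegular g) = if k = g then 1 else 0 := by
  rw [coeff_apply, leftRegular_single, lp.single_apply, Pi.single_apply]
  simp

/-- Elements of `C*_r(N)` have Fourier coefficients supported in `N`. -/
theorem coeff_eq_zero_of_mem_reducedSubalgebra {N : Subgroup Γ} {x : EllTwo Γ →L[ℂ] EllTwo Γ}
    (hx : x ∈ reducedSubalgebra N) {k : Γ} (hk : k ∉ N) : coeff k x = 0 := by
  classical
  refine mem_of_mem_reducedSubalgebra (LinearMap.ker (coeff k).toLinearMap)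
    (coeff k).isClosed_ker ?_ hx
  intro g hg
  have : k ≠ g := by rintro rfl; exact hk hg
  simp [coeff_leftRegular, this]

/-- An operator on `ℓ²(Γ)` that kills every `δ_h = λ(h)δ₁` is zero. -/
theorem eq_zero_of_coeff_mul_leftRegular {x : EllTwo Γ →L[ℂ] EllTwo Γ}
    (hx : ∀ h k, coeff k (x * leftRegular h) = 0) : x = 0 := by
  classical
  have hs : ∀ h, x (lp.single 2 h (1 : ℂ)) = 0 := by
    intro h
    ext k
    have := hx h k
    rw [coeff_apply, mul_apply_eq_comp, leftRegular_single, mul_one] at this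
    simpa using this
  ext1 ξ
  have h1 := (lp.hasSum_single (E := fun _ : Γ => ℂ) (p := 2) (by norm_num) ξ).mapL x
  have h2 : ∀ i, x (lp.single 2 i (ξ i)) = 0 := by
    intro i
    have : lp.single 2 i (ξ i) = ξ i • (lp.single 2 i (1 : ℂ) : EllTwo Γ) := by
      rw [← lp.single_smul]; simp
    rw [this, map_smul, hs, smul_zero]
  simp only [h2] at h1
  exact h1.unique hasSum_zero

/-- Under the C*-ISR property every nonzero ideal of `C*_r(Γ)` has codimension at most one:
`ℂ + J` is an invariant subalgebra, hence some `C*_r(N)`, and `N` is everything, since for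
`g ∉ N` both `J` and `λ(g)J` would be contained in `C*_r(N)`. -/
theorem HasCStarISR.exists_sub_smul_one_mem (hISR : HasCStarISR Γ)
    {J : Submodule ℂ (EllTwo Γ →L[ℂ] EllTwo Γ)} (hJ : IsReducedIdeal J) (hne : J ≠ ⊥) (g : Γ) :
    ∃ c : ℂ, leftRegular g - c • 1 ∈ J := by
  obtain ⟨N, -, hN⟩ := hISR _ hJ.isInvariantSubalgebra_unitization
  rw [← hJ.mem_unitization, hN]
  apply leftRegular_mem_reducedSubalgebra
  by_contra hg
  refine hne ((Submodule.eq_bot_iff _).mpr fun x hx => eq_zero_of_coeff_mul_leftRegular ?_)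
  intro h k
  have hy := hJ.mul_leftRegular_mem h x hx
  have hy1 : x * leftRegular h ∈ reducedSubalgebra N := hN ▸ hJ.le_unitization hy
  have hy2 : leftRegular g * (x * leftRegular h) ∈ reducedSubalgebra N :=
    hN ▸ hJ.le_unitization (hJ.leftRegular_mul_mem g _ hy)
  by_cases hk : k ∈ N
  · have hgk : g * k ∉ N := fun h' => hg ((N.mul_mem_cancel_right hk).mp h')
    simpa [coeff_leftRegular_mul] using coeff_eq_zero_of_mem_reducedSubalgebra hy2 hgk
  · exact coeff_eq_zero_of_mem_reducedSubalgebra hy1 hk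

end Ideals

/-! ### Vectors of `ℓ²`: absolute values and restrictions -/

section Vectors

variable {X : Type*}

theorem hasSum_norm_sq (ξ : EllTwo X) : HasSum (fun h => ‖ξ h‖ ^ 2) (‖ξ‖ ^ 2) := by
  simpa using lp.hasSum_norm (p := 2) (by norm_num) ξ

theorem memℓp_two_of_summable {f : X → ℂ} (hf : Summable fun h => ‖f h‖ ^ 2) : Memℓp f 2 :=
  memℓp_gen (by simpa using hf)

theorem norm_le_of_norm_apply_le {ξ η : EllTwo X} (h : ∀ k, ‖ξ k‖ ≤ ‖η k‖) : ‖ξ‖ ≤ ‖η‖ :=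
  lp.norm_mono two_ne_zero h

/-- The pointwise absolute value of a vector of `ℓ²`. -/
noncomputable def absVec (ξ : EllTwo X) : EllTwo X :=
  ⟨fun h => (‖ξ h‖ : ℂ), memℓp_two_of_summable (by simpa using (hasSum_norm_sq ξ).summable)⟩

theorem absVec_apply (ξ : EllTwo X) (h : X) : absVec ξ h = (‖ξ h‖ : ℂ) := rfl

theorem norm_absVec (ξ : EllTwo X) : ‖absVec ξ‖ = ‖ξ‖ :=
  le_antisymm (norm_le_of_norm_apply_le fun k => by simp [absVec_apply])
    (norm_le_of_norm_apply_le fun k => by simp [absVec_apply])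

/-- Restriction of a vector of `ℓ²(X)` to a subset of `X`, extended by zero. -/
noncomputable def restrict (S : Set X) : EllTwo X →ₗ[ℂ] EllTwo X where
  toFun ξ := ⟨S.indicator ξ, memℓp_two_of_summable <|
    (hasSum_norm_sq ξ).summable.of_nonneg_of_le (fun _ => by positivity) fun h =>
      pow_le_pow_left₀ (norm_nonneg _) (norm_indicator_le_norm_self _ _) 2⟩
  map_add' ξ η := by
    ext h
    exact congrFun (Set.indicator_add S (ξ : X → ℂ) η) h
  map_smul' c ξ := by
    ext h
    exact congrFun (Set.indicator_const_smul S c (ξ : X → ℂ)) h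

theorem restrict_apply (S : Set X) (ξ : EllTwo X) (h : X) :
    restrict S ξ h = S.indicator ξ h := rfl

theorem norm_restrict_le (S : Set X) (ξ : EllTwo X) : ‖restrict S ξ‖ ≤ ‖ξ‖ :=
  norm_le_of_norm_apply_le fun _ => norm_indicator_le_norm_self _ _

theorem restrict_univ (ξ : EllTwo X) : restrict Set.univ ξ = ξ := by
  ext h
  simp [restrict_apply]

theorem norm_restrict_union_sq {S T : Set X} (hST : Disjoint S T) (ξ : EllTwo X) :
    ‖restrict (S ∪ T) ξ‖ ^ 2 = ‖restrict S ξ‖ ^ 2 + ‖restrict T ξ‖ ^ 2 := by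
  refine (hasSum_norm_sq (restrict (S ∪ T) ξ)).unique ?_
  convert! (hasSum_norm_sq (restrict S ξ)).add (hasSum_norm_sq (restrict T ξ)) using 2 with h
  simp only [restrict_apply]
  by_cases hS : h ∈ S
  · have hT : h ∉ T := Set.disjoint_left.mp hST hS
    simp [hS, hT]
  · by_cases hT : h ∈ T <;> simp [hS, hT]

/-- Pythagoras for the decomposition of a vector over the fibres of a map. -/
theorem hasSum_norm_restrict_fiber_sq {Y : Type*} (f : X → Y) (ξ : EllTwo X) :
    HasSum (fun y => ‖restrict (f ⁻¹' {y}) ξ‖ ^ 2) (‖ξ‖ ^ 2) := by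
  convert! (hasSum_norm_sq ξ).tsum_fiberwise f using 2 with y
  rw [← (hasSum_norm_sq _).tsum_eq, tsum_subtype (f ⁻¹' {y}) (fun h => ‖ξ h‖ ^ 2)]
  congr 1
  ext h
  by_cases hh : h ∈ f ⁻¹' {y}
  · simp only [restrict_apply, Set.indicator_of_mem hh]
  · simp only [restrict_apply, Set.indicator_of_notMem hh]
    simp

end Vectors

/-! ### Almost invariant vectors from an ideal of codimension one -/

section AlmostInvariant

variable {Γ : Type*} [Group Γ]

theorem leftRegular_restrict (g : Γ) (S : Set Γ) (ξ : EllTwo Γ) :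
    leftRegular g (restrict S ξ) = restrict ((fun h => g * h) '' S) (leftRegular g ξ) := by
  classical
  ext h
  have : h ∈ (fun h => g * h) '' S ↔ g⁻¹ * h ∈ S := by
    simp [Set.image_mul_left]
  simp only [leftRegular_apply, restrict_apply, Set.indicator_apply, this]

variable (Γ) in

/-- The left regular representation has almost invariant unit vectors. -/
def HasAlmostInvariantVectors : Prop :=
  ∀ (F : Finset Γ) (ε : ℝ), 0 < ε → ∃ ξ : EllTwo Γ, ‖ξ‖ = 1 ∧ ∀ g ∈ F, ‖leftRegular g ξ - ξ‖ < ε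

/-- If every `λ(g)` is a scalar modulo the self-adjoint ideal `J`, that scalar has modulus one. -/
theorem IsReducedIdeal.exists_one_sub_smul_mem {J : Submodule ℂ (EllTwo Γ →L[ℂ] EllTwo Γ)}
    (hJ : IsReducedIdeal J) (h1 : (1 : EllTwo Γ →L[ℂ] EllTwo Γ) ∉ J) {g : Γ}
    (hg : ∃ c : ℂ, leftRegular g - c • 1 ∈ J) :
    ∃ c : ℂ, ‖c‖ = 1 ∧ 1 - c • leftRegular g ∈ J := by
  obtain ⟨c, hc⟩ := hg
  have h2 : (1 : EllTwo Γ →L[ℂ] EllTwo Γ) - star c • leftRegular g ∈ J := by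
    have := hJ.leftRegular_mul_mem g _ (hJ.star_mem _ hc)
    rwa [star_sub, star_leftRegular, star_smul, star_one, mul_sub, ← map_mul, mul_inv_cancel,
      map_one, mul_smul_comm, mul_one] at this
  refine ⟨star c, ?_, h2⟩
  have h3 : (1 - star c * c) • (1 : EllTwo Γ →L[ℂ] EllTwo Γ) ∈ J := by
    have := J.add_mem h2 (J.smul_mem (star c) hc)
    convert! this using 1
    rw [smul_sub, smul_smul, sub_smul, one_smul]
    abel
  have h4 : 1 - star c * c = 0 := by
    by_contra hne
    have := J.smul_mem (1 - star c * c)⁻¹ h3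
    rw [smul_smul, inv_mul_cancel₀ hne, one_smul] at this
    exact h1 this
  have h5 : ‖c‖ * ‖c‖ = 1 := by
    have := congrArg norm (sub_eq_zero.mp h4)
    simpa using this.symm
  rw [norm_star]
  nlinarith [norm_nonneg c]

theorem norm_leftRegular_absVec_sub_le (g : Γ) {c : ℂ} (hc : ‖c‖ = 1) (ξ : EllTwo Γ) :
    ‖leftRegular g (absVec ξ) - absVec ξ‖ ≤ ‖c • leftRegular g ξ - ξ‖ := by
  refine norm_le_of_norm_apply_le fun k => ?_
  have h1 : (leftRegular g (absVec ξ) - absVec ξ) k = ((‖ξ (g⁻¹ * k)‖ - ‖ξ k‖ : ℝ) : ℂ) := by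
    push_cast
    rfl
  have h2 : (c • leftRegular g ξ - ξ) k = c * ξ (g⁻¹ * k) - ξ k := rfl
  rw [h1, h2, Complex.norm_real, Real.norm_eq_abs]
  simpa [hc] using abs_norm_sub_norm_le (c * ξ (g⁻¹ * k)) (ξ k)

/-- If every `λ(g)` is a scalar modulo a proper ideal, then averages of suitable multiples of
unitaries `λ(g)` have norm one, and vectors at which the norm is nearly attained have almost
invariant absolute value. -/
theorem IsReducedIdeal.hasAlmostInvariantVectors {J : Submodule ℂ (EllTwo Γ →L[ℂ] EllTwo Γ)}
    (hJ : IsReducedIdeal J) (h1 : (1 : EllTwo Γ →L[ℂ] EllTwo Γ) ∉ J)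
    (hcodim : ∀ g : Γ, ∃ c : ℂ, leftRegular g - c • 1 ∈ J) : HasAlmostInvariantVectors Γ := by
  classical
  choose c hc hcJ using fun g => hJ.exists_one_sub_smul_mem h1 (hcodim g)
  intro F ε hε
  let u : Γ → (EllTwo Γ →L[ℂ] EllTwo Γ) := fun g => c g • leftRegular g
  have hu : ∀ g ξ, ‖u g ξ‖ = ‖ξ‖ := fun g ξ => by
    change ‖c g • leftRegular g ξ‖ = ‖ξ‖
    rw [norm_smul, hc, one_mul, leftRegular_norm_apply]
  let B : EllTwo Γ →L[ℂ] EllTwo Γ := 1 + ∑ g ∈ F, u g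
  -- Each `u g` is `1` modulo `J`, so `B / (#F + 1)` is too and cannot have
  -- norm below `1`.
  have hB : ((F.card : ℝ) + 1) ≤ ‖B‖ := by
    by_contra! hlt
    have hpos : (0 : ℝ) < (F.card : ℝ) + 1 := by positivity
    have hne : ((F.card : ℂ) + 1) ≠ 0 := by exact_mod_cast hpos.ne'
    refine h1 (hJ.one_mem_of_norm_lt_one (b := ((F.card : ℂ) + 1)⁻¹ • B) ?_ ?_ ?_)
    · exact SMulMemClass.smul_mem _ (add_mem (one_mem _) (sum_mem fun g _ =>
        SMulMemClass.smul_mem _ (leftRegular_mem g)))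
    · have : ‖((F.card : ℂ) + 1)⁻¹‖ = ((F.card : ℝ) + 1)⁻¹ := by
        rw [norm_inv]
        congr 1
        exact_mod_cast Complex.norm_natCast (F.card + 1)
      rw [norm_smul, this, inv_mul_lt_iff₀ hpos, mul_one]
      exact hlt
    · have : (1 : EllTwo Γ →L[ℂ] EllTwo Γ) - ((F.card : ℂ) + 1)⁻¹ • B =
          ((F.card : ℂ) + 1)⁻¹ • ∑ g ∈ F, (1 - u g) := by
        have : ∑ g ∈ F, (1 - u g) = ((F.card : ℂ) + 1) • (1 : EllTwo Γ →L[ℂ] EllTwo Γ) - B := by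
          rw [Finset.sum_sub_distrib, Finset.sum_const, add_smul, one_smul, Nat.cast_smul_eq_nsmul]
          simp only [B]
          abel
        rw [this, smul_sub, smul_smul, inv_mul_cancel₀ hne, one_smul]
      rw [this]
      exact J.smul_mem _ (J.sum_mem fun g _ => hcJ g)
  -- By the parallelogram law, `‖ξ + u ξ‖ > 2 - δ` forces `‖u ξ - ξ‖² < 4δ` for a unit vector `ξ`.
  obtain ⟨δ, hδ, hδε, hδ1⟩ : ∃ δ : ℝ, 0 < δ ∧ 4 * δ ≤ ε ^ 2 ∧ δ ≤ 1 :=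
    ⟨min (ε ^ 2 / 4) 1, by positivity, by linarith [min_le_left (ε ^ 2 / 4) 1], min_le_right _ _⟩
  obtain ⟨ξ, hξ, hBξ⟩ : ∃ ξ : EllTwo Γ, ‖ξ‖ = 1 ∧ (F.card : ℝ) + 1 - δ < ‖B ξ‖ := by
    have hr : (0 : ℝ) ≤ (F.card : ℝ) + 1 - δ := by
      have : (0 : ℝ) ≤ F.card := by positivity
      linarith
    by_contra! hcon
    have hle : ‖B‖ ≤ (F.card : ℝ) + 1 - δ :=
      B.opNorm_le_of_unit_norm hr hcon
    linarith
  refine ⟨absVec ξ, (norm_absVec ξ).trans hξ, fun g hg => ?_⟩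
  refine (norm_leftRegular_absVec_sub_le g (hc g) ξ).trans_lt ?_
  change ‖u g ξ - ξ‖ < ε
  have hsum : ‖∑ k ∈ F.erase g, u k ξ‖ ≤ (F.card : ℝ) - 1 := by
    refine (norm_sum_le _ _).trans ?_
    simp only [hu, hξ, Finset.sum_const, Finset.card_erase_of_mem hg, nsmul_eq_mul, mul_one]
    rw [Nat.cast_sub (Finset.card_pos.mpr ⟨g, hg⟩)]
    simp
  -- The remaining `#F - 1` unitaries contribute at most `#F - 1`, leaving more than `2 - δ` for
  -- `u g ξ + ξ`.
  have hdecomp : B ξ = (u g ξ + ξ) + ∑ k ∈ F.erase g, u k ξ := by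
    simp only [B, add_apply, sum_apply, one_apply_eq_self]
    rw [← Finset.add_sum_erase F _ hg]
    abel
  have h2 : 2 - δ < ‖u g ξ + ξ‖ := by
    have := norm_add_le (u g ξ + ξ) (∑ k ∈ F.erase g, u k ξ)
    rw [← hdecomp] at this
    linarith
  have hpar := parallelogram_law_with_norm ℂ (u g ξ) ξ
  rw [hu, hξ] at hpar
  refine lt_of_pow_lt_pow_left₀ 2 hε.le ?_
  nlinarith

end AlmostInvariant

/-! ### Amenability -/

section Amenable

variable {Γ : Type*} [Group Γ]

/-- Amenability from almost invariant vectors: a limit point of the measures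
`S ↦ ‖1_S ξ‖²` along almost invariant unit vectors `ξ` is an invariant mean. -/
theorem HasAlmostInvariantVectors.isAmenable (h : HasAlmostInvariantVectors Γ) :
    IsAmenable Γ := by
  classical
  -- The index `(F, n)` stands for invariance under `F` up to `1 / (n + 1)`.
  choose ξ hξ hinv using fun i : Finset Γ × ℕ => h i.1 (1 / ((i.2 : ℝ) + 1)) (by positivity)
  let 𝒰 : Ultrafilter (Finset Γ × ℕ) := Ultrafilter.of Filter.atTop
  have h𝒰 : (𝒰 : Filter (Finset Γ × ℕ)) ≤ Filter.atTop := Ultrafilter.of_le _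
  have hlim : ∀ g, Filter.Tendsto (fun i => ‖leftRegular g (ξ i) - ξ i‖) 𝒰 (nhds 0) := by
    intro g
    have hsnd : Filter.Tendsto (fun i : Finset Γ × ℕ => i.2) 𝒰 Filter.atTop :=
      (Filter.prod_atTop_atTop_eq (α := Finset Γ) (β := ℕ) ▸ Filter.tendsto_snd).mono_left h𝒰
    refine squeeze_zero' (Filter.Eventually.of_forall fun _ => norm_nonneg _) ?_
      (tendsto_one_div_add_atTop_nhds_zero_nat.comp hsnd)
    filter_upwards [h𝒰 (Filter.eventually_ge_atTop ({g}, 0))] with i hi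
    exact (hinv i g (hi.1 (Finset.mem_singleton_self g))).le
  have hmem : ∀ S i, ‖restrict S (ξ i)‖ ^ 2 ∈ Set.Icc (0 : ℝ) 1 := fun S i =>
    ⟨by positivity, pow_le_one₀ (norm_nonneg _) ((norm_restrict_le S _).trans (hξ i).le)⟩
  have hex : ∀ S : Set Γ, ∃ m ∈ Set.Icc (0 : ℝ) 1,
      Filter.Tendsto (fun i => ‖restrict S (ξ i)‖ ^ 2) 𝒰 (nhds m) := fun S =>
    isCompact_Icc.ultrafilter_le_nhds (𝒰.map fun i => ‖restrict S (ξ i)‖ ^ 2)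
      (Filter.le_principal_iff.mpr (Filter.eventually_map.mpr
        (Filter.Eventually.of_forall (hmem S))))
  choose μ hμ hμlim using hex
  refine ⟨μ, fun S => (hμ S).1, ?_, fun S T hST => ?_, fun g S => ?_⟩
  · refine tendsto_nhds_unique (hμlim Set.univ) ?_
    simp only [restrict_univ, hξ, one_pow]
    exact tendsto_const_nhds
  · refine tendsto_nhds_unique (hμlim (S ∪ T)) ?_
    simp only [norm_restrict_union_sq hST]
    exact (hμlim S).add (hμlim T)
  · refine tendsto_nhds_unique (hμlim _) ?_
    have hdiff : Filter.Tendsto (fun i => ‖restrict ((fun h => g * h) '' S) (ξ i)‖ ^ 2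
        - ‖restrict S (ξ i)‖ ^ 2) 𝒰 (nhds 0) := by
      have h2 : Filter.Tendsto (fun i => 2 * ‖leftRegular g (ξ i) - ξ i‖) 𝒰 (nhds 0) := by
        simpa using (hlim g).const_mul 2
      refine squeeze_zero_norm (fun i => ?_) h2
      set a := ‖restrict ((fun h => g * h) '' S) (ξ i)‖
      have ha : a ≤ 1 := (norm_restrict_le _ _).trans (hξ i).le
      have hb : ‖restrict S (ξ i)‖ ≤ 1 := (norm_restrict_le _ _).trans (hξ i).le
      have hab : |a - ‖restrict S (ξ i)‖| ≤ ‖leftRegular g (ξ i) - ξ i‖ := by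
        rw [← leftRegular_norm_apply g (restrict S (ξ i)), leftRegular_restrict]
        refine (abs_norm_sub_norm_le _ _).trans ?_
        rw [← map_sub, ← norm_neg (leftRegular g (ξ i) - ξ i), neg_sub]
        exact norm_restrict_le _ _
      have ha0 : 0 ≤ a := norm_nonneg _
      have hb0 := norm_nonneg (restrict S (ξ i))
      rw [Real.norm_eq_abs, sq_sub_sq, abs_mul, abs_of_nonneg (by positivity)]
      exact mul_le_mul (by linarith) hab (abs_nonneg _) zero_le_two
    simpa using hdiff.add (hμlim S)

end Amenable

/-! ### Normal subgroups and simplicity -/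

section NormalSubgroup

variable {Γ : Type*} [Group Γ]

/-- Almost invariant vectors for a normal subgroup `N` can be found supported in a single coset
of `N`, since the displacement by `N` and the norm both decompose over the cosets. -/
theorem HasAlmostInvariantVectors.exists_supported_in_coset (h : HasAlmostInvariantVectors Γ)
    (N : Subgroup Γ) [N.Normal] (F : Finset Γ) (hF : ∀ n ∈ F, n ∈ N) {ε : ℝ} (hε : 0 < ε) :
    ∃ ξ : EllTwo Γ, ξ ≠ 0 ∧ (∃ y : Γ ⧸ N, ∀ k : Γ, (k : Γ ⧸ N) ≠ y → ξ k = 0) ∧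
      ∀ n ∈ F, ‖leftRegular n ξ - ξ‖ ≤ ε * ‖ξ‖ := by
  classical
  -- The tolerance makes the squared displacements over `F` sum to less than `ε ^ 2`.
  obtain ⟨η, hη, hinv⟩ := h F (ε / (F.card + 1)) (by positivity)
  let P : Γ ⧸ N → EllTwo Γ →ₗ[ℂ] EllTwo Γ := fun y => restrict ((fun k : Γ => (k : Γ ⧸ N)) ⁻¹' {y})
  have hcomm : ∀ n ∈ N, ∀ y, leftRegular n (P y η) - P y η = P y (leftRegular n η - η) := by
    intro n hn y
    have himg : (fun h => n * h) '' ((fun k : Γ => (k : Γ ⧸ N)) ⁻¹' {y}) =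
        (fun k : Γ => (k : Γ ⧸ N)) ⁻¹' {y} := by
      ext k
      have : ((n : Γ) : Γ ⧸ N) = 1 := (QuotientGroup.eq_one_iff n).mpr hn
      simp [Set.image_mul_left, this]
    rw [map_sub, leftRegular_restrict, himg]
  have hsum : HasSum (fun y => ∑ n ∈ F, ‖leftRegular n (P y η) - P y η‖ ^ 2)
      (∑ n ∈ F, ‖leftRegular n η - η‖ ^ 2) := by
    refine hasSum_sum fun n hn => ?_
    simp only [hcomm n (hF n hn)]
    exact hasSum_norm_restrict_fiber_sq _ _
  have hnorm : HasSum (fun y => ε ^ 2 * ‖P y η‖ ^ 2) (ε ^ 2 * ‖η‖ ^ 2) :=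
    (hasSum_norm_restrict_fiber_sq _ η).mul_left _
  have hlt : ∑ n ∈ F, ‖leftRegular n η - η‖ ^ 2 < ε ^ 2 * ‖η‖ ^ 2 := by
    calc ∑ n ∈ F, ‖leftRegular n η - η‖ ^ 2 ≤ ∑ n ∈ F, (ε / (F.card + 1)) ^ 2 :=
          Finset.sum_le_sum fun n hn => pow_le_pow_left₀ (norm_nonneg _) (hinv n hn).le 2
      _ = ε ^ 2 * (F.card / (F.card + 1 : ℝ) ^ 2) := by
          rw [Finset.sum_const, nsmul_eq_mul, div_pow]
          ring
      _ < ε ^ 2 * ‖η‖ ^ 2 := by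
          rw [hη, one_pow]
          refine mul_lt_mul_of_pos_left ?_ (by positivity)
          rw [div_lt_one (by positivity)]
          have : (0 : ℝ) ≤ F.card := by positivity
          nlinarith
  obtain ⟨y, hy⟩ : ∃ y, ∑ n ∈ F, ‖leftRegular n (P y η) - P y η‖ ^ 2 < ε ^ 2 * ‖P y η‖ ^ 2 := by
    by_contra! hcon
    exact hlt.not_ge (hasSum_le hcon hnorm hsum)
  refine ⟨P y η, ?_, ⟨y, fun k hk => ?_⟩, fun n hn => ?_⟩
  · intro h0
    rw [h0] at hy
    simp at hy
  · exact Set.indicator_of_notMem (by simpa using hk) _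
  · refine le_of_sq_le_sq ?_ (by positivity)
    rw [mul_pow]
    exact (Finset.single_le_sum (f := fun n => ‖leftRegular n (P y η) - P y η‖ ^ 2)
      (fun _ _ => by positivity) hn).trans hy.le

/-- The linear span of the differences `λ(g) - λ(h)` with `gN = hN`. -/
noncomputable def relationSpan (N : Subgroup Γ) : Submodule ℂ (EllTwo Γ →L[ℂ] EllTwo Γ) :=
  Submodule.span ℂ {x | ∃ g h : Γ, g⁻¹ * h ∈ N ∧ x = leftRegular g - leftRegular h}

theorem relation_mem {N : Subgroup Γ} {g h : Γ} (hgh : g⁻¹ * h ∈ N) :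
    leftRegular g - leftRegular h ∈ relationSpan N :=
  Submodule.subset_span ⟨g, h, hgh, rfl⟩

/-- The closure of `relationSpan N` is the closed ideal of `C*_r(Γ)` generated by the elements
`1 - λ(n)`, `n ∈ N`. -/
theorem isReducedIdeal_relationSpan (N : Subgroup Γ) [hN : N.Normal] :
    IsReducedIdeal (relationSpan N).topologicalClosure where
  le_reduced := by
    have hle : relationSpan N ≤ Subalgebra.toSubmodule (reducedCStarAlgebra Γ).toSubalgebra := by
      refine Submodule.span_le.mpr ?_
      rintro _ ⟨g, h, -, rfl⟩
      exact sub_mem (leftRegular_mem g) (leftRegular_mem h)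
    have hcl : closure (relationSpan N : Set (EllTwo Γ →L[ℂ] EllTwo Γ)) ⊆ reducedCStarAlgebra Γ :=
      closure_minimal hle isClosed_reducedCStarAlgebra
    exact fun x hx => hcl hx
  isClosed := Submodule.isClosed_topologicalClosure _
  star_mem x hx := by
    refine map_mem_closure continuous_star hx fun y hy => ?_
    induction hy using Submodule.span_induction with
    | mem y hy =>
      obtain ⟨g, h, hgh, rfl⟩ := hy
      rw [star_sub, star_leftRegular, star_leftRegular]
      exact relation_mem (by simpa [mul_assoc] using N.inv_mem (hN.conj_mem _ hgh g))
    | zero => simp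
    | add y z _ _ hy hz => rw [star_add]; exact add_mem hy hz
    | smul c y _ hy => rw [star_smul]; exact Submodule.smul_mem _ _ hy
  leftRegular_mul_mem k x hx := by
    refine map_mem_closure (f := (leftRegular k * ·)) (continuous_const_mul _) hx fun y hy => ?_
    change leftRegular k * y ∈ relationSpan N
    induction hy using Submodule.span_induction with
    | mem y hy =>
      obtain ⟨g, h, hgh, rfl⟩ := hy
      rw [mul_sub, ← map_mul, ← map_mul]
      exact relation_mem (by simpa [mul_assoc] using hgh)
    | zero => simp
    | add y z _ _ hy hz => rw [mul_add]; exact add_mem hy hz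
    | smul c y _ hy => rw [mul_smul_comm]; exact Submodule.smul_mem _ _ hy
  mul_leftRegular_mem k x hx := by
    refine map_mem_closure (f := (· * leftRegular k)) (continuous_mul_const _) hx fun y hy => ?_
    change y * leftRegular k ∈ relationSpan N
    induction hy using Submodule.span_induction with
    | mem y hy =>
      obtain ⟨g, h, hgh, rfl⟩ := hy
      rw [sub_mul, ← map_mul, ← map_mul]
      exact relation_mem (by simpa [mul_assoc] using hN.conj_mem _ hgh k⁻¹)
    | zero => simp
    | add y z _ _ hy hz => rw [add_mul]; exact add_mem hy hz
    | smul c y _ hy => rw [smul_mul_assoc]; exact Submodule.smul_mem _ _ hy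

theorem relationSpan_topologicalClosure_ne_bot {N : Subgroup Γ} (hN : N ≠ ⊥) :
    (relationSpan N).topologicalClosure ≠ ⊥ := by
  obtain ⟨n, hn, hn1⟩ := N.bot_or_exists_ne_one.resolve_left hN
  intro h0
  have hmem : leftRegular (1 : Γ) - leftRegular n ∈ (relationSpan N).topologicalClosure :=
    Submodule.le_topologicalClosure _ (relation_mem (by simpa using hn))
  rw [h0, Submodule.mem_bot] at hmem
  have := congrArg (coeff (1 : Γ)) hmem
  simp [coeff_leftRegular, hn1.symm, -map_one] at this

/-- Elements of `relationSpan N` are small on vectors almost invariant under `N`. -/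
theorem exists_norm_apply_le_of_mem_relationSpan {N : Subgroup Γ}
    {z : EllTwo Γ →L[ℂ] EllTwo Γ} (hz : z ∈ relationSpan N) :
    ∃ F : Finset Γ, (∀ n ∈ F, n ∈ N) ∧ ∃ C : ℝ, 0 ≤ C ∧ ∀ ξ : EllTwo Γ, ∀ δ : ℝ,
      (∀ n ∈ F, ‖leftRegular n ξ - ξ‖ ≤ δ) → 0 ≤ δ → ‖z ξ‖ ≤ C * δ := by
  classical
  induction hz using Submodule.span_induction with
  | mem z hz =>
    obtain ⟨g, h, hgh, rfl⟩ := hz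
    refine ⟨{g⁻¹ * h}, by simpa using hgh, 1, zero_le_one, fun ξ δ hξ _ => ?_⟩
    have h1 : (leftRegular g - leftRegular h) ξ =
        leftRegular g (ξ - leftRegular (g⁻¹ * h) ξ) := by
      rw [map_sub, ← mul_apply_eq_comp, ← map_mul]
      simp
    rw [h1, leftRegular_norm_apply, norm_sub_rev, one_mul]
    exact hξ _ (Finset.mem_singleton_self _)
  | zero => exact ⟨∅, by simp, 0, le_rfl, by simp⟩
  | add y z _ _ hy hz =>
    obtain ⟨F, hF, C, hC, h1⟩ := hy
    obtain ⟨G, hG, D, hD, h2⟩ := hz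
    refine ⟨F ∪ G, fun n hn => (Finset.mem_union.mp hn).elim (hF n) (hG n), C + D,
      add_nonneg hC hD, fun ξ δ hξ hδ => ?_⟩
    rw [add_mul]
    exact (norm_add_le _ _).trans (add_le_add
      (h1 ξ δ (fun n hn => hξ n (Finset.mem_union_left _ hn)) hδ)
      (h2 ξ δ (fun n hn => hξ n (Finset.mem_union_right _ hn)) hδ))
  | smul c y _ hy =>
    obtain ⟨F, hF, C, hC, h1⟩ := hy
    refine ⟨F, hF, ‖c‖ * C, by positivity, fun ξ δ hξ hδ => ?_⟩
    change ‖c • y ξ‖ ≤ _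
    rw [norm_smul, mul_assoc]
    exact mul_le_mul_of_nonneg_left (h1 ξ δ hξ hδ) (norm_nonneg _)

/-- If `ξ` is supported in a coset of `N` and `g ∉ N`, then `λ(g)ξ` and `ξ` have disjoint
supports, so subtracting a multiple of `ξ` from `λ(g)ξ` does not decrease the norm. -/
theorem norm_le_norm_leftRegular_sub_smul {N : Subgroup Γ} [hN : N.Normal] {g : Γ} (hg : g ∉ N)
    {ξ : EllTwo Γ} {y : Γ ⧸ N} (hξ : ∀ k : Γ, (k : Γ ⧸ N) ≠ y → ξ k = 0) (c : ℂ) :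
    ‖ξ‖ ≤ ‖leftRegular g ξ - c • ξ‖ := by
  rw [← leftRegular_norm_apply g ξ]
  refine norm_le_of_norm_apply_le fun k => ?_
  have h2 : (leftRegular g ξ - c • ξ) k = ξ (g⁻¹ * k) - c * ξ k := rfl
  rw [h2, leftRegular_apply]
  by_cases hk : (k : Γ ⧸ N) = y
  · have : ((g⁻¹ * k : Γ) : Γ ⧸ N) ≠ y := by
      rw [← hk]
      intro h
      exact hg ((QuotientGroup.eq_one_iff g).mp (by simpa using h))
    rw [hξ _ this, norm_zero]
    exact norm_nonneg _
  · simp [hξ _ hk]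

/-- With almost invariant vectors, no translate `λ(g)`, `g ∉ N`, is scalar modulo the ideal
generated by the elements `1 - λ(n)`, `n ∈ N`. -/
theorem HasAlmostInvariantVectors.sub_smul_one_notMem (h : HasAlmostInvariantVectors Γ)
    (N : Subgroup Γ) [N.Normal] {g : Γ} (hg : g ∉ N) (c : ℂ) :
    leftRegular g - c • 1 ∉ (relationSpan N).topologicalClosure := by
  intro hmem
  -- Approximate by `z` in the span up to `1 / 2`, then pick `ξ` with `‖z ξ‖ ≤ ‖ξ‖ / 4`; since
  -- `1 / 2 + 1 / 4 < 1`, this contradicts `norm_le_norm_leftRegular_sub_smul`.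
  obtain ⟨z, hz, hdist⟩ := Metric.mem_closure_iff.mp hmem (1 / 2) (by norm_num)
  obtain ⟨F, hF, C, hC, hzC⟩ := exists_norm_apply_le_of_mem_relationSpan hz
  obtain ⟨ξ, hξ0, ⟨y, hy⟩, hinv⟩ :=
    h.exists_supported_in_coset N F hF (ε := 1 / (4 * (C + 1))) (by positivity)
  have hpos : 0 < ‖ξ‖ := norm_pos_iff.mpr hξ0
  have h1 : ‖z ξ‖ ≤ 1 / 4 * ‖ξ‖ := by
    refine (hzC ξ _ hinv (by positivity)).trans ?_
    rw [← mul_assoc]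
    refine mul_le_mul_of_nonneg_right ?_ hpos.le
    rw [mul_one_div, div_le_iff₀ (by positivity)]
    linarith
  have h2 : ‖leftRegular g ξ - c • ξ - z ξ‖ ≤ 1 / 2 * ‖ξ‖ := by
    rw [dist_eq_norm] at hdist
    exact ContinuousLinearMap.le_of_opNorm_le _ hdist.le ξ
  have h3 := norm_le_norm_leftRegular_sub_smul hg hy c
  have h4 := norm_sub_norm_le (leftRegular g ξ - c • ξ) (z ξ)
  linarith

theorem HasCStarISR.isSimpleGroup [Nontrivial Γ] (hISR : HasCStarISR Γ)
    (h : HasAlmostInvariantVectors Γ) : IsSimpleGroup Γ where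
  eq_bot_or_eq_top_of_normal N hN := by
    by_contra! hcon
    obtain ⟨g, hg⟩ : ∃ g, g ∉ N := by
      by_contra! hall
      exact hcon.2 ((Subgroup.eq_top_iff' N).mpr hall)
    obtain ⟨c, hc⟩ := hISR.exists_sub_smul_one_mem (isReducedIdeal_relationSpan N)
      (relationSpan_topologicalClosure_ne_bot hcon.1) g
    exact h.sub_smul_one_notMem N hg c hc

end NormalSubgroup

/-! ### Closed ideals of the reduced C*-algebra -/

section Dichotomy

variable {Γ : Type*} [Group Γ]

/-- The self-adjoint part `I ∩ I*` of a two-sided ideal `I` of `C*_r(Γ)`, as a subspace of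
`B(ℓ²(Γ))`. -/
def selfAdjointPart (I : TwoSidedIdeal (reducedCStarAlgebra Γ)) :
    Submodule ℂ (EllTwo Γ →L[ℂ] EllTwo Γ) where
  carrier := {x | ∃ a ∈ I, star a ∈ I ∧ (a : EllTwo Γ →L[ℂ] EllTwo Γ) = x}
  zero_mem' := ⟨0, I.zero_mem, by simp [I.zero_mem], rfl⟩
  add_mem' := by
    rintro _ _ ⟨a, ha, ha', rfl⟩ ⟨b, hb, hb', rfl⟩
    exact ⟨a + b, I.add_mem ha hb, by simpa using I.add_mem ha' hb', rfl⟩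
  smul_mem' := by
    rintro c _ ⟨a, ha, ha', rfl⟩
    have hs : ∀ (d : ℂ) (b : reducedCStarAlgebra Γ), b ∈ I → d • b ∈ I := fun d b hb => by
      simpa using I.mul_mem_left (d • 1) b hb
    exact ⟨c • a, hs c a ha, by rw [star_smul]; exact hs _ _ ha', rfl⟩

theorem isReducedIdeal_selfAdjointPart {I : TwoSidedIdeal (reducedCStarAlgebra Γ)}
    (hI : IsClosed (I : Set (reducedCStarAlgebra Γ))) : IsReducedIdeal (selfAdjointPart I) where
  le_reduced := by
    rintro _ ⟨a, -, -, rfl⟩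
    exact a.2
  isClosed := by
    have hcl : IsClosed {a : reducedCStarAlgebra Γ | a ∈ I ∧ star a ∈ I} :=
      hI.inter (hI.preimage continuous_star)
    convert! isClosed_reducedCStarAlgebra.isClosedEmbedding_subtypeVal.isClosedMap _ hcl using 1
    ext x
    exact ⟨fun ⟨a, ha, ha', h⟩ => ⟨a, ⟨ha, ha'⟩, h⟩, fun ⟨a, ⟨ha, ha'⟩, h⟩ => ⟨a, ha, ha', h⟩⟩
  star_mem := by
    rintro _ ⟨a, ha, ha', rfl⟩
    exact ⟨star a, ha', by rwa [star_star], rfl⟩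
  leftRegular_mul_mem g := by
    rintro _ ⟨a, ha, ha', rfl⟩
    exact ⟨⟨leftRegular g, leftRegular_mem g⟩ * a, I.mul_mem_left _ _ ha,
      by rw [star_mul]; exact I.mul_mem_right _ _ ha', rfl⟩
  mul_leftRegular_mem g := by
    rintro _ ⟨a, ha, ha', rfl⟩
    exact ⟨a * ⟨leftRegular g, leftRegular_mem g⟩, I.mul_mem_right _ _ ha,
      by rw [star_mul]; exact I.mul_mem_left _ _ ha', rfl⟩

theorem selfAdjointPart_ne_bot {I : TwoSidedIdeal (reducedCStarAlgebra Γ)} (hI : I ≠ ⊥) :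
    selfAdjointPart I ≠ ⊥ := by
  intro h0
  refine hI (eq_bot_iff.mpr fun a ha => ?_)
  -- If `a ∈ I`, then `a a*` is a self-adjoint element of `I`, nonzero unless `a = 0`.
  have hmem : ((a * star a : reducedCStarAlgebra Γ) : EllTwo Γ →L[ℂ] EllTwo Γ) ∈
      selfAdjointPart I :=
    ⟨a * star a, I.mul_mem_right _ _ ha, by
      rw [star_mul, star_star]; exact I.mul_mem_right _ _ ha, rfl⟩
  rw [h0, Submodule.mem_bot] at hmem
  have : (a : EllTwo Γ →L[ℂ] EllTwo Γ) = 0 := CStarRing.mul_star_self_eq_zero_iff _ |>.mp hmem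
  exact (TwoSidedIdeal.mem_bot _).mpr (Subtype.ext this)

theorem one_notMem_selfAdjointPart {I : TwoSidedIdeal (reducedCStarAlgebra Γ)} (hI : I ≠ ⊤) :
    (1 : EllTwo Γ →L[ℂ] EllTwo Γ) ∉ selfAdjointPart I := by
  rintro ⟨a, ha, -, h⟩
  have : a = 1 := Subtype.ext h
  exact hI (I.one_mem_iff.mp (this ▸ ha))

/-- A nontrivial closed ideal of `C*_r(Γ)` has codimension one, so that `C*_r(Γ)` has a character;
this is a form of amenability. -/
theorem HasCStarISR.hasAlmostInvariantVectors (hISR : HasCStarISR Γ) (h : ¬ IsCStarSimple Γ) :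
    HasAlmostInvariantVectors Γ := by
  simp only [IsCStarSimple, not_forall, not_or] at h
  obtain ⟨I, hI, hbot, htop⟩ := h
  have hJ := isReducedIdeal_selfAdjointPart hI
  exact hJ.hasAlmostInvariantVectors (one_notMem_selfAdjointPart htop)
    (hISR.exists_sub_smul_one_mem hJ (selfAdjointPart_ne_bot hbot))

end Dichotomy

/-! ### Conjugacy classes -/

section ICC

variable {Γ : Type*} [Group Γ]

/-- The centre of `C*_r(Γ)` consists of scalars if `Γ` is C*-simple: if `s` is a spectral value
of the central element `z`, then `z - s` generates a proper closed ideal. -/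
theorem IsCStarSimple.exists_eq_algebraMap (h : IsCStarSimple Γ) {z : reducedCStarAlgebra Γ}
    (hz : ∀ a, z * a = a * z) : ∃ s : ℂ, z = algebraMap ℂ _ s := by
  have : CompleteSpace (reducedCStarAlgebra Γ) :=
    isClosed_reducedCStarAlgebra.completeSpace_coe
  have : Nontrivial (reducedCStarAlgebra Γ) := by
    refine ⟨0, 1, fun h01 => ?_⟩
    have h1 : (0 : EllTwo Γ →L[ℂ] EllTwo Γ) = leftRegular 1 :=
      (congrArg Subtype.val h01).trans (map_one _).symm
    simpa [coeff_leftRegular, -map_one] using congrArg (coeff (1 : Γ)) h1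
  obtain ⟨s, hs⟩ := spectrum.nonempty z
  refine ⟨s, ?_⟩
  set w := algebraMap ℂ (reducedCStarAlgebra Γ) s - z with hw
  have hwc : ∀ a, w * a = a * w := fun a => by
    rw [hw, sub_mul, mul_sub, hz, Algebra.commutes]
  let V : Set (reducedCStarAlgebra Γ) := closure (Set.range fun a => w * a)
  let I : TwoSidedIdeal (reducedCStarAlgebra Γ) := TwoSidedIdeal.mk' V
    (subset_closure ⟨0, by simp⟩)
    (fun hx hy => map_mem_closure₂ continuous_add hx hy (by
      rintro _ ⟨a, rfl⟩ _ ⟨b, rfl⟩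
      exact ⟨a + b, mul_add _ _ _⟩))
    (fun hx => map_mem_closure continuous_neg hx (by
      rintro _ ⟨a, rfl⟩
      exact ⟨-a, mul_neg _ _⟩))
    (fun {x y} hy => map_mem_closure (f := (x * ·)) (continuous_const_mul x) hy (by
      rintro _ ⟨a, rfl⟩
      exact ⟨x * a, by simp only [← mul_assoc, hwc x]⟩))
    (fun {x y} hx => map_mem_closure (f := (· * y)) (continuous_mul_const y) hx (by
      rintro _ ⟨a, rfl⟩
      exact ⟨a * y, by simp only [mul_assoc]⟩))
  have hmemI : ∀ x, x ∈ I ↔ x ∈ V := TwoSidedIdeal.mem_mk' _ _ _ _ _ _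
  have hclosed : IsClosed (I : Set (reducedCStarAlgebra Γ)) := by
    have : (I : Set (reducedCStarAlgebra Γ)) = V := Set.ext hmemI
    rw [this]
    exact isClosed_closure
  rcases h I hclosed with hI | hI
  · have : w ∈ I := (hmemI w).mpr (subset_closure ⟨1, mul_one w⟩)
    rw [hI, TwoSidedIdeal.mem_bot] at this
    exact (sub_eq_zero.mp this).symm
  · exfalso
    have h1 : (1 : reducedCStarAlgebra Γ) ∈ V := (hmemI 1).mp (hI ▸ trivial)
    obtain ⟨_, ⟨a, rfl⟩, ha⟩ := Metric.mem_closure_iff.mp h1 1 one_pos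
    rw [dist_eq_norm] at ha
    have hu : IsUnit (w * a) := by simpa using isUnit_one_sub_of_norm_lt_one ha
    have hcomm : Commute w a := hwc a
    exact hs ((hcomm.isUnit_mul_iff.mp hu).1)

/-- A finite conjugacy class other than `{1}` would give a central element `∑ λ(k)` of `C*_r(Γ)`
that is not a scalar. -/
theorem IsCStarSimple.isICC (h : IsCStarSimple Γ) : IsICC Γ := by
  classical
  intro g hg hfin
  let C : Finset Γ := hfin.toFinset
  have hC : ∀ k, k ∈ C ↔ IsConj g k := fun k => by simp [C, conjugatesOf]
  let z : EllTwo Γ →L[ℂ] EllTwo Γ := ∑ k ∈ C, leftRegular k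
  have hz : z ∈ reducedCStarAlgebra Γ := sum_mem fun k _ => leftRegular_mem k
  have hcomm : ∀ h, z * leftRegular h = leftRegular h * z := by
    intro h
    simp only [z, Finset.sum_mul, Finset.mul_sum, ← map_mul]
    refine Finset.sum_bij' (fun k _ => h⁻¹ * k * h) (fun k _ => h * k * h⁻¹) ?_ ?_ ?_ ?_ ?_
    · intro k hk
      exact (hC _).mpr (((hC k).mp hk).trans (isConj_iff.mpr ⟨h⁻¹, by simp⟩))
    · intro k hk
      exact (hC _).mpr (((hC k).mp hk).trans (isConj_iff.mpr ⟨h, rfl⟩))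
    all_goals intros; simp [mul_assoc]
  have hcentral : ∀ a : reducedCStarAlgebra Γ, (⟨z, hz⟩ : reducedCStarAlgebra Γ) * a =
      a * ⟨z, hz⟩ := by
    rintro ⟨a, ha⟩
    refine Subtype.ext (sub_eq_zero.mp ?_)
    let T : (EllTwo Γ →L[ℂ] EllTwo Γ) →L[ℂ] (EllTwo Γ →L[ℂ] EllTwo Γ) :=
      ContinuousLinearMap.mul ℂ _ z - (ContinuousLinearMap.mul ℂ _).flip z
    exact mem_of_mem_reducedCStarAlgebra (LinearMap.ker T.toLinearMap) T.isClosed_ker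
      (fun h => sub_eq_zero.mpr (hcomm h)) ha
  obtain ⟨s, hs⟩ := h.exists_eq_algebraMap hcentral
  have hzs : z = s • leftRegular 1 := by
    rw [map_one, ← Algebra.algebraMap_eq_smul_one]
    exact congrArg Subtype.val hs
  have h1 := congrArg (coeff g) hzs
  have hgC : g ∈ C := (hC g).mpr (IsConj.refl g)
  simp [z, coeff_leftRegular, hg, hgC, -map_one] at h1

/-- If `g` has finite conjugacy class, the normal core of its centralizer is a normal subgroup of
finite index. In an infinite simple group this is the whole group, so `g` is central; a nontrivial
centre makes the group abelian, hence finite of prime order. -/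
theorem isICC_of_isSimpleGroup [Infinite Γ] [IsSimpleGroup Γ] : IsICC Γ := by
  intro g hg hfin
  let S : Subgroup (ConjAct Γ) := MulAction.stabilizer (ConjAct Γ) g
  have hS : S.FiniteIndex := by
    refine ⟨?_⟩
    have horb : MulAction.orbit (ConjAct Γ) g = conjugatesOf g := by
      ext k
      rw [ConjAct.mem_orbit_conjAct, isConj_comm]
      rfl
    rw [MulAction.index_stabilizer, horb]
    exact Set.ncard_ne_zero_of_mem (a := g) (IsConj.refl g) hfin
  let H : Subgroup Γ := S.comap ConjAct.toConjAct.toMonoidHom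
  have hHfin : H.FiniteIndex := ⟨by
    rw [Subgroup.index_comap_of_surjective _ ConjAct.toConjAct.surjective]
    exact hS.index_ne_zero⟩
  have hH : H.normalCore.FiniteIndex := inferInstance
  have hHtop : H.normalCore = ⊤ := by
    refine (inferInstance : H.normalCore.Normal).eq_bot_or_eq_top.resolve_left fun h0 => ?_
    rw [h0] at hH
    exact hH.index_ne_zero (by simp)
  have hgc : g ∈ Subgroup.center Γ := by
    refine Subgroup.mem_center_iff.mpr fun k => ?_
    have hk : k ∈ H := H.normalCore_le (hHtop ▸ Subgroup.mem_top k)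
    exact mul_inv_eq_iff_eq_mul.mp (show k * g * k⁻¹ = g from hk)
  have hnt : Subgroup.center Γ ≠ ⊥ := fun h0 => hg (Subgroup.mem_bot.mp (h0 ▸ hgc))
  have htop : Subgroup.center Γ = ⊤ :=
    (inferInstance : (Subgroup.center Γ).Normal).eq_bot_or_eq_top.resolve_left hnt
  have : IsMulCommutative Γ := ⟨⟨fun a b => by
    have : b ∈ Subgroup.center Γ := htop ▸ Subgroup.mem_top b
    exact Subgroup.mem_center_iff.mp this a⟩⟩
  have hp := Group.is_simple_iff_prime_card.mp (inferInstance : IsSimpleGroup Γ)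
  simp at hp
  exact absurd hp (by norm_num)

end ICC

end CStarISR

theorem mainTheorem4 (Γ : Type*) [Group Γ] [Countable Γ] [Infinite Γ]
    (hISR : CStarISR.HasCStarISR Γ) :
    (CStarISR.IsCStarSimple Γ ∨ (IsSimpleGroup Γ ∧ CStarISR.IsAmenable Γ)) ∧
      CStarISR.IsICC Γ := by
  by_cases h : CStarISR.IsCStarSimple Γ
  · exact ⟨Or.inl h, h.isICC⟩
  · have hv := hISR.hasAlmostInvariantVectors h
    have := hISR.isSimpleGroup hv
    exact ⟨Or.inr ⟨inferInstance, hv.isAmenable⟩, CStarISR.isICC_of_isSimpleGroup⟩
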